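/- Let $L^2=L^2(\mathbb T,dm)$, where $m$ is normalized Lebesgue measure on the unit circle $\mathbb T$, and let $H^2\subset L^2$ be the subspace of functions whose negative Fourier coefficients vanish. An inner function is an element of $H^2$ of modulus $1$ almost everywhere. For $\varphi\in L^\infty(\mathbb T)$ let $T_\varphi f=P_{H^2}(\varphi f)$ be the Toeplitz operator on $H^2$. For an inner function $\theta$ let $K_\theta=H^2\ominus\theta H^2$, and for inner $\theta,B$ let $A^\theta_B=P_{K_\theta}T_B|_{K_\theta}$. If $V$ is a bounded operator on a Hilbert space $\mathcal K$, a closed subspace $X\subset\mathcal K$ is called wandering for $V$ if $V^nX\perp V^mX$ for all $n\neq m$, and $M_+(X)$ denotes the closed linear span of $V^nX$, $n\ge 0$ (the orthogonal sum $\bigoplus_{n\ge0}V^nX$). An isometry $V$ on $\mathcal K$ is an isometric dilation of an operator $T$ on a closed subspace $\mathcal H\subset\mathcal K$ if $P_{\mathcal H}V^n|_{\mathcal H}=T^n$ for all $n\ge 0$; it is minimal if $\mathcal K$ is the closed linear span of the subspaces $V^n\mathcal H$, $n\ge0$. For a contraction $T$, put $D_T=(I-T^*T)^{1/2}$ and $\mathcal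 D_T=\overline{D_T\mathcal H}$. **Theorem.** Let $B$ and $\theta$ be inner functions, with $B$ not constant, such that $\ker T_{\theta\overline B}=\{0\}$. Then $V=T_B$ on $H^2$ is a minimal isometric dilation of $T=A^\theta_B$. The wandering subspaces of this dilation are $L=\theta K_B$ and $L_*=K_B$, that is: 1. $L=\theta K_B$ and $L_*=K_B$ are closed subspaces wandering for $T_B$, with $$H^2=M_+(L_*)=K_\theta\oplus M_+(L)\quad\text{(orthogonal sum)},$$ and they are the only pair of wandering subspaces with this property; 2. the maps $D_Tx\mapsto (V-T)x$ and $D_{T^*}x\mapsto x-VT^*x$ $(x\in K_\theta)$ extend to unitary operators from $\mathcal D_T$ onto $\theta K_B$ and from $\mathcal D_{T^*}$ onto $K_B$, respectively; in particular $\dim \theta K_B=\dim\mathcal D_T$ and $\dim K_B=\dim\mathcal D_{T^*}$. -/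

import Mathlib

open MeasureTheory
open scoped ENNReal

noncomputable section

namespace HardyDilation

/-! ### Isometric dilations, wandering subspaces and defects

Throughout, `K` is a complex Hilbert space, `H` a closed subspace of `K` (the instance
`H.HasOrthogonalProjection` provides the orthogonal projection `P_H`), `V` a bounded operator
on `K` and `T` a bounded operator on `H`. -/

/-- `V` on `K ⊇ H` is an isometric dilation of `T` on `H`: `V` is an isometry and
`P_H V ^ n | H = T ^ n` for all `n`. -/
structure IsIsometricDilation {K : Type*} [NormedAddCommGroup K] [InnerProductSpace ℂ K]
    (H : Submodule ℂ K) [H.HasOrthogonalProjection] (V : K →L[ℂ] K) (T : H →L[ℂ] H) : Prop where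
  isometry : ∀ x : K, ‖V x‖ = ‖x‖
  compression_pow : ∀ (n : ℕ) (x : H), H.orthogonalProjectionOnto ((V ^ n) (x : K)) = (T ^ n) x

/-- An isometric dilation is minimal if `K` is the closed linear span of the subspaces
`V ^ n H`, `n ≥ 0`. -/
structure IsMinimalIsometricDilation {K : Type*} [NormedAddCommGroup K] [InnerProductSpace ℂ K]
    (H : Submodule ℂ K) [H.HasOrthogonalProjection] (V : K →L[ℂ] K) (T : H →L[ℂ] H) : Prop
    extends IsIsometricDilation H V T where
  span_eq_top : (⨆ n : ℕ, H.map (V ^ n).toLinearMap).topologicalClosure = ⊤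

/-- A closed subspace `X` is wandering for `V` if `V ^ n X ⟂ V ^ m X` whenever `n ≠ m`. -/
structure IsWandering {K : Type*} [NormedAddCommGroup K] [InnerProductSpace ℂ K]
    (V : K →L[ℂ] K) (X : Submodule ℂ K) : Prop where
  isClosed : IsClosed (X : Set K)
  isOrtho : ∀ n m : ℕ, n ≠ m → X.map (V ^ n).toLinearMap ⟂ X.map (V ^ m).toLinearMap

/-- `M₊(X)`, the closed span of the subspaces `V ^ n X`, `n ≥ 0`. When `X` is wandering for `V`,
this is their orthogonal direct sum. -/
def MPlus {K : Type*} [NormedAddCommGroup K] [InnerProductSpace ℂ K]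
    (V : K →L[ℂ] K) (X : Submodule ℂ K) : Submodule ℂ K :=
  (⨆ n : ℕ, X.map (V ^ n).toLinearMap).topologicalClosure

/-- `L` and `Lstar` are wandering subspaces for `V` with
`K = M₊(Lstar) = H ⊕ M₊(L)` (orthogonal sum). -/
structure IsWanderingDecomposition {K : Type*} [NormedAddCommGroup K] [InnerProductSpace ℂ K]
    (H : Submodule ℂ K) (V : K →L[ℂ] K) (L Lstar : Submodule ℂ K) : Prop where
  wandering : IsWandering V L
  wandering_star : IsWandering V Lstar
  mPlus_star : MPlus V Lstar = ⊤
  ortho : H ⟂ MPlus V L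
  sup_eq_top : H ⊔ MPlus V L = ⊤

/-- The defect operator `D_T = (I - T* T) ^ (1/2)` of a contraction `T`. -/
def defectOperator {H : Type*} [NormedAddCommGroup H] [InnerProductSpace ℂ H] [CompleteSpace H]
    (T : H →L[ℂ] H) : H →L[ℂ] H :=
  CFC.sqrt (1 - ContinuousLinearMap.adjoint T * T)

/-- The defect space of `T`, the closure of the range of `D_T`. -/
def defectSpace {H : Type*} [NormedAddCommGroup H] [InnerProductSpace ℂ H] [CompleteSpace H]
    (T : H →L[ℂ] H) : Submodule ℂ H :=
  (defectOperator T).range.topologicalClosure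

/-- `D_T x` as an element of the defect space. -/
def toDefect {H : Type*} [NormedAddCommGroup H] [InnerProductSpace ℂ H] [CompleteSpace H]
    (T : H →L[ℂ] H) (x : H) : defectSpace T :=
  ⟨defectOperator T x, Submodule.le_topologicalClosure _ ⟨x, rfl⟩⟩

/-- The map `D_T x ↦ (V - T) x` extends to a unitary operator from the defect space of `T`
onto `L`. -/
def IdentifiesDefect {K : Type*} [NormedAddCommGroup K] [InnerProductSpace ℂ K]
    (H : Submodule ℂ K) [CompleteSpace H] (V : K →L[ℂ] K) (T : H →L[ℂ] H)
    (L : Submodule ℂ K) : Prop :=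
  ∃ φ : defectSpace T ≃ₗᵢ[ℂ] L,
    ∀ x : H, (φ (toDefect T x) : K) = V (x : K) - ((T x : H) : K)

/-- The map `D_{T*} x ↦ x - V T* x` extends to a unitary operator from the defect space of `T*`
onto `Lstar`. -/
def IdentifiesDefectStar {K : Type*} [NormedAddCommGroup K] [InnerProductSpace ℂ K]
    (H : Submodule ℂ K) [CompleteSpace H] (V : K →L[ℂ] K) (T : H →L[ℂ] H)
    (Lstar : Submodule ℂ K) : Prop :=
  ∃ φstar : defectSpace (ContinuousLinearMap.adjoint T) ≃ₗᵢ[ℂ] Lstar,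
    ∀ x : H, (φstar (toDefect (ContinuousLinearMap.adjoint T) x) : K) =
      (x : K) - V ((ContinuousLinearMap.adjoint T x : H) : K)

/-! ### Hardy space, Toeplitz operators and model spaces

The unit circle with normalized Lebesgue measure is parametrized by
`t ↦ exp (2 π i t)`, `t ∈ ℝ / ℤ`. -/

/-- `L²` of the unit circle. -/
abbrev L2 : Type := Lp ℂ 2 (AddCircle.haarAddCircle : Measure UnitAddCircle)

/-- `L^∞` of the unit circle. -/
abbrev LInfty : Type := Lp ℂ ∞ (AddCircle.haarAddCircle : Measure UnitAddCircle)

/-- The Hardy space `H²`: functions in `L²` whose negative Fourier coefficients vanish. -/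
def H2 : Submodule ℂ L2 where
  carrier := {f | ∀ n : ℤ, n < 0 → fourierCoeff f n = 0}
  zero_mem' := by
    intro n _
    rw [← fourierBasis_repr, map_zero]
    rfl
  add_mem' := by
    intro f g hf hg n hn
    have h1 := hf n hn
    have h2 := hg n hn
    rw [← fourierBasis_repr] at h1 h2 ⊢
    rw [map_add, lp.coeFn_add, Pi.add_apply, h1, h2, add_zero]
  smul_mem' := by
    intro c f hf n hn
    have h1 := hf n hn
    rw [← fourierBasis_repr] at h1 ⊢
    rw [map_smul, lp.coeFn_smul, Pi.smul_apply, h1, smul_zero]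

theorem isClosed_H2 : IsClosed (H2 : Set L2) := by
  have h : (H2 : Set L2) = ⋂ n : ℤ, ⋂ _ : n < 0,
      {f : L2 | inner ℂ (fourierBasis (T := (1 : ℝ)) n) f = 0} := by
    ext f
    simp only [Set.mem_iInter, Set.mem_ofPred_eq, ← HilbertBasis.repr_apply_apply,
      fourierBasis_repr]
    rfl
  rw [h]
  refine isClosed_iInter fun n => isClosed_iInter fun _ => ?_
  exact isClosed_eq (by fun_prop) continuous_const

instance : CompleteSpace H2 := isClosed_H2.completeSpace_coe

/-- Inner functions: elements of `H²` with modulus `1` almost everywhere on the circle. They are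
bounded, so they are given here as elements of `L^∞ ⊆ L²`. -/
structure IsInner (θ : LInfty) : Prop where
  fourierCoeff_eq_zero : ∀ n : ℤ, n < 0 → fourierCoeff θ n = 0
  norm_eq_one : ∀ᵐ t ∂(AddCircle.haarAddCircle : Measure UnitAddCircle), ‖θ t‖ = 1

/-- `θ` is almost everywhere equal to a constant. -/
def IsConstant (θ : LInfty) : Prop :=
  ∃ c : ℂ, ∀ᵐ t ∂(AddCircle.haarAddCircle : Measure UnitAddCircle), θ t = c

/-- The pointwise product in `L^∞`. -/
def mulLInfty (φ ψ : LInfty) : LInfty :=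
  (ContinuousLinearMap.mul ℂ ℂ).holder ∞ φ ψ

/-- The operator `f ↦ φ f` on `L²`. -/
def mulOp (φ : LInfty) : L2 →L[ℂ] L2 :=
  (ContinuousLinearMap.mul ℂ ℂ).holderL AddCircle.haarAddCircle ∞ 2 2 φ

/-- The Toeplitz operator `T_φ` on `H²`, the compression of multiplication by `φ`. -/
def toeplitz (φ : LInfty) : H2 →L[ℂ] H2 :=
  H2.orthogonalProjectionOnto ∘L mulOp φ ∘L H2.subtypeL

/-- The subspace `θ X = {f ∈ H² | f = θ g for some g ∈ X}` of `H²`, for `X ⊆ H²`. -/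
def innerMul (θ : LInfty) (X : Submodule ℂ H2) : Submodule ℂ H2 :=
  ((X.map H2.subtype).map (mulOp θ).toLinearMap).comap H2.subtype

/-- The model space `K_θ = H² ⊖ θ H²`. -/
abbrev modelSpace (θ : LInfty) : Submodule ℂ H2 :=
  (innerMul θ ⊤)ᗮ

/-- The truncated Toeplitz operator `A^θ_B = P_{K_θ} T_B | K_θ` on `K_θ`. -/
def truncatedToeplitz (θ B : LInfty) : modelSpace θ →L[ℂ] modelSpace θ :=
  (modelSpace θ).orthogonalProjectionOnto ∘L toeplitz B ∘L (modelSpace θ).subtypeL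

end HardyDilation

end

namespace HardyDilation

/-! ### Wandering subspaces and the Wold decomposition. -/

section Abstract

variable {E : Type*} [NormedAddCommGroup E] [InnerProductSpace ℂ E]

/-! Everything reduces to two commuting isometries `V = T_B` and `W = T_θ`, with `K_θ = (ran W)ᗮ`
and `K_B = (ran V)ᗮ`. Two facts from function theory are needed: `V` is pure, i.e. the ranges of its
powers meet only in `0` (`IsInner.toeplitz_pure`), and the Toeplitz operator with symbol `θ B̄`
equals `V* W` (`IsInner.toeplitz_mulLInfty_star`), so that `V* W` is injective.

By Wold's theorem purity gives `M₊(K_B) = H²`; applying `W` gives `M₊(θ K_B) = ran W = K_θᗮ`. A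
wandering subspace is recovered from its `M₊` as `M₊ ⊖ V M₊`, hence uniqueness. The dilation
property holds because `ran W` is `V`-invariant.

Injectivity of `V* W` enters through minimality and through surjectivity of the two defect maps. The
maps preserve norms by Pythagoras, so only density of their ranges is at stake, and a vector of the
target orthogonal to the range is forced into the form `W y` with `V* W y = 0`. -/

theorem mem_orthogonal_mPlus {V : E →L[ℂ] E} {X : Submodule ℂ E} {y : E} :
    y ∈ (MPlus V X)ᗮ ↔ ∀ n : ℕ, ∀ x ∈ X, inner ℂ ((V ^ n) x) y = 0 := by
  rw [MPlus, Submodule.orthogonal_closure, ← Submodule.iInf_orthogonal]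
  simp only [Submodule.mem_iInf, Submodule.mem_orthogonal]
  exact forall_congr' fun n => by simp only [Submodule.mem_map, forall_exists_index, and_imp,
    forall_apply_eq_imp_iff₂, ContinuousLinearMap.coe_coe]

theorem pow_mem_mPlus (V : E →L[ℂ] E) {X : Submodule ℂ E} (n : ℕ) {x : E} (hx : x ∈ X) :
    (V ^ n) x ∈ MPlus V X :=
  Submodule.le_topologicalClosure _ <|
    Submodule.mem_iSup_of_mem n (Submodule.mem_map_of_mem (f := (V ^ n).toLinearMap) hx)

theorem le_mPlus (V : E →L[ℂ] E) (X : Submodule ℂ E) : X ≤ MPlus V X := fun _ hx => by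
  simpa using pow_mem_mPlus V 0 hx

theorem mPlus_le {V : E →L[ℂ] E} {X M : Submodule ℂ E} (hM : IsClosed (M : Set E))
    (h : ∀ n : ℕ, ∀ x ∈ X, (V ^ n) x ∈ M) : MPlus V X ≤ M := by
  refine Submodule.topologicalClosure_minimal _ (iSup_le fun n => ?_) hM
  rintro _ ⟨x, hx, rfl⟩
  exact h n x hx

theorem isClosed_mPlus (V : E →L[ℂ] E) (X : Submodule ℂ E) : IsClosed (MPlus V X : Set E) :=
  Submodule.isClosed_topologicalClosure _

theorem map_mPlus_of_commute {V W : E →L[ℂ] E} (hVW : Commute V W) (X : Submodule ℂ E)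
    {x : E} (hx : x ∈ MPlus V X) : W x ∈ MPlus V (X.map W.toLinearMap) := by
  have : MPlus V X ≤ (MPlus V (X.map W.toLinearMap)).comap W.toLinearMap := by
    refine mPlus_le ((isClosed_mPlus V _).preimage W.continuous) fun n x hx => ?_
    have h : W ((V ^ n) x) = (V ^ n) (W x) :=
      (DFunLike.congr_fun (hVW.pow_left n).eq x).symm
    rw [Submodule.mem_comap, ContinuousLinearMap.coe_coe, h]
    exact pow_mem_mPlus V n (Submodule.mem_map_of_mem (f := W.toLinearMap) hx)
  exact this hx

theorem isWandering_iff_inner {V : E →L[ℂ] E} {X : Submodule ℂ E} (hX : IsClosed (X : Set E)) :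
    IsWandering V X ↔ ∀ n m : ℕ, n ≠ m → ∀ x ∈ X, ∀ y ∈ X,
      inner ℂ ((V ^ n) x) ((V ^ m) y) = 0 := by
  refine ⟨fun h n m hnm x hx y hy => ?_, fun h => ⟨hX, fun n m hnm => ?_⟩⟩
  · exact (Submodule.isOrtho_iff_inner_eq.1 (h.isOrtho n m hnm)) _
      (Submodule.mem_map_of_mem (f := (V ^ n).toLinearMap) hx) _
      (Submodule.mem_map_of_mem (f := (V ^ m).toLinearMap) hy)
  · rw [Submodule.isOrtho_iff_inner_eq]
    rintro _ ⟨x, hx, rfl⟩ _ ⟨y, hy, rfl⟩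
    exact h n m hnm x hx y hy

theorem IsWanderingDecomposition.mPlus_eq {H : Submodule ℂ E} {V : E →L[ℂ] E}
    {L Lstar : Submodule ℂ E} (h : IsWanderingDecomposition H V L Lstar) : MPlus V L = Hᗮ := by
  refine le_antisymm h.ortho.symm fun y hy => ?_
  obtain ⟨a, ha, b, hb, rfl⟩ := Submodule.mem_sup.1 (h.sup_eq_top ▸ Submodule.mem_top : y ∈ _)
  have hbH : b ∈ Hᗮ := h.ortho.symm hb
  have haH : a ∈ Hᗮ := by simpa using sub_mem hy hbH
  have : a = 0 := (Submodule.mem_bot ℂ).1 <| (Submodule.inf_orthogonal_eq_bot H) ▸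
    Submodule.mem_inf.2 ⟨ha, haH⟩
  simpa [this] using hb

theorem norm_pow_apply_of_isometry {V : E →L[ℂ] E} (hV : ∀ x, ‖V x‖ = ‖x‖) (n : ℕ) (x : E) :
    ‖(V ^ n) x‖ = ‖x‖ := by
  induction n with
  | zero => simp
  | succ n ih => rw [pow_succ', mul_apply_eq_comp, hV, ih]

variable [CompleteSpace E]

/-- A wandering subspace is `M₊(X) ⊖ V M₊(X)`. -/
theorem IsWandering.eq_inf {V : E →L[ℂ] E} {X : Submodule ℂ E} (hX : IsWandering V X) :
    X = MPlus V X ⊓ ((MPlus V X).map V.toLinearMap)ᗮ := by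
  have hin := (isWandering_iff_inner hX.isClosed).1 hX
  have : CompleteSpace X := hX.isClosed.completeSpace_coe
  apply le_antisymm
  · refine le_inf (le_mPlus V X) fun x hx => ?_
    have : MPlus V X ≤ (ℂ ∙ x)ᗮ.comap V.toLinearMap := by
      refine mPlus_le ((Submodule.isClosed_orthogonal _).preimage V.continuous) fun n y hy => ?_
      rw [Submodule.mem_comap, Submodule.mem_orthogonal_singleton_iff_inner_right]
      simpa [pow_succ'] using hin 0 (n + 1) (by omega) x hx y hy
    rintro _ ⟨z, hz, rfl⟩
    exact Submodule.mem_orthogonal_singleton_iff_inner_left.1 (this hz)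
  · rintro y ⟨hyM, hyV⟩
    have hsub : y - X.starProjection y ∈ MPlus V X :=
      sub_mem hyM (le_mPlus V X (by simp))
    -- The difference is orthogonal to `X` by projection; for positive powers both terms are
    -- orthogonal to `V ^ (n + 1) X` separately.
    have horth : y - X.starProjection y ∈ (MPlus V X)ᗮ := by
      rw [mem_orthogonal_mPlus]
      rintro (_ | n) x hx
      · exact (Submodule.sub_starProjection_mem_orthogonal y) x hx
      · rw [inner_sub_right]
        have h1 : inner ℂ ((V ^ (n + 1)) x) y = 0 := by
          refine hyV _ ⟨(V ^ n) x, pow_mem_mPlus V n hx, ?_⟩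
          simp [pow_succ']
        have h2 := hin (n + 1) 0 (by omega) x hx (X.starProjection y) (by simp)
        rw [h1, show inner ℂ ((V ^ (n + 1)) x) (X.starProjection y) = 0 by simpa using h2, sub_zero]
    have h0 : y - X.starProjection y = 0 :=
      (Submodule.mem_bot ℂ).1 <| (Submodule.inf_orthogonal_eq_bot (MPlus V X)) ▸
        Submodule.mem_inf.2 ⟨hsub, horth⟩
    rw [sub_eq_zero.1 h0]
    simp

theorem IsWandering.eq_of_mPlus_eq {V : E →L[ℂ] E} {X Y : Submodule ℂ E} (hX : IsWandering V X)
    (hY : IsWandering V Y) (h : MPlus V X = MPlus V Y) : X = Y := by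
  rw [hX.eq_inf, hY.eq_inf, h]

theorem IsWanderingDecomposition.unique {H : Submodule ℂ E} {V : E →L[ℂ] E}
    {L Lstar L' Lstar' : Submodule ℂ E} (h : IsWanderingDecomposition H V L Lstar)
    (h' : IsWanderingDecomposition H V L' Lstar') : L = L' ∧ Lstar = Lstar' :=
  ⟨h.wandering.eq_of_mPlus_eq h'.wandering (h.mPlus_eq.trans h'.mPlus_eq.symm),
    h.wandering_star.eq_of_mPlus_eq h'.wandering_star (h.mPlus_star.trans h'.mPlus_star.symm)⟩

open ContinuousLinearMap in
theorem adjoint_apply_apply_of_isometry {V : E →L[ℂ] E} (hV : ∀ x, ‖V x‖ = ‖x‖) (x : E) :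
    adjoint V (V x) = x :=
  DFunLike.congr_fun ((norm_map_iff_adjoint_comp_self V).1 hV) x

theorem inner_map_map_of_isometry {V : E →L[ℂ] E} (hV : ∀ x, ‖V x‖ = ‖x‖) (x y : E) :
    inner ℂ (V x) (V y) = inner ℂ x y := by
  rw [← ContinuousLinearMap.adjoint_inner_right, adjoint_apply_apply_of_isometry hV]

theorem isClosed_range_of_isometry {V : E →L[ℂ] E} (hV : ∀ x, ‖V x‖ = ‖x‖) :
    IsClosed (V.range : Set E) := by
  have : Isometry V := AddMonoidHomClass.isometry_of_norm V hV
  rw [LinearMap.coe_range]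
  exact this.isClosedEmbedding.isClosed_range

theorem orthogonal_orthogonal_range {V : E →L[ℂ] E} (hV : ∀ x, ‖V x‖ = ‖x‖) :
    V.rangeᗮᗮ = V.range := by
  rw [Submodule.orthogonal_orthogonal_eq_closure,
    (isClosed_range_of_isometry hV).submodule_topologicalClosure_eq]

theorem mem_orthogonal_range {V : E →L[ℂ] E} {x : E} :
    x ∈ V.rangeᗮ ↔ ContinuousLinearMap.adjoint V x = 0 := by
  rw [ContinuousLinearMap.orthogonal_range]; rfl

theorem isWandering_orthogonal_range {V : E →L[ℂ] E} (hV : ∀ x, ‖V x‖ = ‖x‖) :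
    IsWandering V V.rangeᗮ := by
  have key : ∀ n k : ℕ, ∀ x ∈ V.rangeᗮ, ∀ y : E,
      inner ℂ ((V ^ n) x) ((V ^ (n + k + 1)) y) = 0 := by
    intro n k x hx y
    rw [add_assoc, pow_add, mul_apply_eq_comp,
      inner_map_map_of_isometry (norm_pow_apply_of_isometry hV n), pow_succ']
    exact Submodule.inner_left_of_mem_orthogonal (LinearMap.mem_range_self _ ((V ^ k) y)) hx
  refine (isWandering_iff_inner (Submodule.isClosed_orthogonal _)).2 fun n m hnm x hx y hy => ?_
  rcases lt_or_gt_of_ne hnm with h | h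
  · obtain ⟨k, rfl⟩ := Nat.exists_eq_add_of_lt h
    exact key n k x hx y
  · obtain ⟨k, rfl⟩ := Nat.exists_eq_add_of_lt h
    exact inner_eq_zero_symm.1 (key m k y hy x)

/-- Wold: a pure isometry is a shift. -/
theorem mPlus_orthogonal_range_eq_top {V : E →L[ℂ] E} (hV : ∀ x, ‖V x‖ = ‖x‖)
    (hpure : ∀ x, (∀ n : ℕ, ∃ y, (V ^ n) y = x) → x = 0) : MPlus V V.rangeᗮ = ⊤ := by
  rw [← (isClosed_mPlus V V.rangeᗮ).submodule_topologicalClosure_eq,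
    Submodule.topologicalClosure_eq_top_iff, Submodule.eq_bot_iff]
  intro y hy
  rw [mem_orthogonal_mPlus] at hy
  refine hpure y fun n => ?_
  induction n with
  | zero => exact ⟨y, rfl⟩
  | succ n ih =>
    obtain ⟨z, rfl⟩ := ih
    -- The isometry `V ^ n` cancels from the orthogonality of `V ^ n z` to `V ^ n (ran V)ᗮ`, so `z`
    -- itself lies in `ran V` and one more power of `V` can be extracted.
    have : z ∈ V.rangeᗮᗮ := fun x hx => by
      rw [← inner_map_map_of_isometry (norm_pow_apply_of_isometry hV n)]
      exact hy n x hx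
    rw [orthogonal_orthogonal_range hV] at this
    obtain ⟨w, rfl⟩ := this
    exact ⟨w, by rw [pow_succ]; rfl⟩

end Abstract

/-! ### Defect operators and unitary extension from the defect space. -/

section Defect

open ContinuousLinearMap

variable {H : Type*} [NormedAddCommGroup H] [InnerProductSpace ℂ H] [CompleteSpace H]

theorem norm_defectOperator_apply_sq {T : H →L[ℂ] H} (hT : ∀ x, ‖T x‖ ^ 2 ≤ ‖x‖ ^ 2) (x : H) :
    ‖defectOperator T x‖ ^ 2 = ‖x‖ ^ 2 - ‖T x‖ ^ 2 := by
  have hin : ∀ x : H, inner ℂ x ((1 - adjoint T * T) x) = ((‖x‖ ^ 2 - ‖T x‖ ^ 2 : ℝ) : ℂ) := by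
    intro x
    rw [sub_apply, inner_sub_right, mul_apply_eq_comp, adjoint_inner_right,
      one_apply_eq_self, inner_self_eq_norm_sq_to_K, inner_self_eq_norm_sq_to_K]
    simp
  have hpos : 0 ≤ 1 - adjoint T * T := by
    rw [nonneg_iff_isPositive, isPositive_def']
    refine ⟨?_, fun x => ?_⟩
    · exact (IsSelfAdjoint.one _).sub (IsSelfAdjoint.star_mul_self T)
    · rw [reApplyInnerSelf_apply, inner_re_symm, hin]
      exact (sub_nonneg.2 (hT x)).trans_eq (RCLike.ofReal_re (K := ℂ) _).symm
  have hsa : adjoint (defectOperator T) = defectOperator T :=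
    (IsSelfAdjoint.of_nonneg (CFC.sqrt_nonneg _)).star_eq
  have hsq : defectOperator T * defectOperator T = 1 - adjoint T * T :=
    CFC.sqrt_mul_sqrt_self _ hpos
  have h : ((‖defectOperator T x‖ ^ 2 : ℝ) : ℂ) = ((‖x‖ ^ 2 - ‖T x‖ ^ 2 : ℝ) : ℂ) := by
    rw [← hin, ← hsq, mul_apply_eq_comp]
    nth_rw 2 [← hsa]
    rw [adjoint_inner_right, inner_self_eq_norm_sq_to_K]
    simp
  exact_mod_cast h

theorem denseRange_toDefect (T : H →L[ℂ] H) : DenseRange (toDefect T) := by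
  intro y
  rw [closure_subtype]
  have : (Subtype.val '' Set.range (toDefect T) : Set H) = (defectOperator T).range := by
    ext z
    simp [toDefect]
  rw [this]
  exact y.2

/-- If `‖A x‖² = ‖x‖² - ‖T x‖²` and `A` has dense range in `L`, then `D_T x ↦ A x` extends to a
unitary operator onto `L`. -/
theorem exists_defectSpace_equiv {E : Type*} [NormedAddCommGroup E] [InnerProductSpace ℂ E]
    [CompleteSpace E] {T : H →L[ℂ] H} {L : Submodule ℂ E} (hL : IsClosed (L : Set E))
    (A : H →L[ℂ] E) (hA : ∀ x, A x ∈ L)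
    (hnorm : ∀ x, ‖A x‖ ^ 2 = ‖x‖ ^ 2 - ‖T x‖ ^ 2)
    (hdense : ∀ y ∈ L, (∀ x, inner ℂ (A x) y = 0) → y = 0) :
    ∃ φ : defectSpace T ≃ₗᵢ[ℂ] L, ∀ x : H, (φ (toDefect T x) : E) = A x := by
  have : CompleteSpace L := hL.completeSpace_coe
  have : CompleteSpace (defectSpace T) :=
    (Submodule.isClosed_topologicalClosure _).completeSpace_coe
  let e : H →ₗ[ℂ] defectSpace T :=
    (defectOperator T).toLinearMap.codRestrict _ fun x => (toDefect T x).2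
  let f : H →ₗ[ℂ] L := A.toLinearMap.codRestrict L hA
  have he : DenseRange e := denseRange_toDefect T
  have hfe : ∀ x, ‖f x‖ = ‖e x‖ := fun x => by
    refine (sq_eq_sq₀ (norm_nonneg _) (norm_nonneg _)).1 ?_
    change ‖A x‖ ^ 2 = ‖defectOperator T x‖ ^ 2
    rw [norm_defectOperator_apply_sq (fun x => ?_), hnorm]
    linarith [hnorm x, sq_nonneg ‖A x‖]
  have hext : ∀ x, f.extendOfNorm e (e x) = f x :=
    LinearMap.extendOfNorm_eq he ⟨1, fun x => by rw [hfe, one_mul]⟩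
  let g : defectSpace T →ₗᵢ[ℂ] L :=
    { (f.extendOfNorm e).toLinearMap with
      norm_map' := fun x => by
        refine he.induction_on (p := fun x => ‖f.extendOfNorm e x‖ = ‖x‖) x
          (isClosed_eq (by fun_prop) (by fun_prop)) fun x => ?_
        rw [hext, hfe] }
  have hg : ∀ x, g (e x) = f x := hext
  have hclosed : IsClosed (g.toLinearMap.range : Set L) := by
    rw [LinearMap.coe_range]
    exact g.isometry.isClosedEmbedding.isClosed_range
  have : CompleteSpace g.toLinearMap.range := hclosed.completeSpace_coe
  -- The range of `g` is closed, so a trivial orthogonal complement suffices.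
  have hsurj : Function.Surjective g := by
    suffices g.toLinearMap.range = ⊤ from LinearMap.range_eq_top.1 this
    rw [← Submodule.orthogonal_eq_bot_iff, Submodule.eq_bot_iff]
    intro y hy
    refine Subtype.ext (hdense y y.2 fun x => ?_)
    exact hy (f x) ⟨e x, hg x⟩
  exact ⟨LinearIsometryEquiv.ofSurjective g hsurj, fun x => congrArg Subtype.val (hg x)⟩

end Defect

/-! ### Compressions of `V` to `(ran W)ᗮ` for commuting isometries `V`, `W`. -/

section Dilation

open ContinuousLinearMap

variable {E : Type*} [NormedAddCommGroup E] [InnerProductSpace ℂ E] [CompleteSpace E]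
  {V W : E →L[ℂ] E} {H : Submodule ℂ E}

omit [CompleteSpace E] in
theorem apply_comm (hVW : Commute V W) (x : E) : V (W x) = W (V x) :=
  DFunLike.congr_fun hVW.eq x

theorem adjoint_apply_comm (hVW : Commute V W) (x : E) :
    adjoint V (adjoint W x) = adjoint W (adjoint V x) := by
  have := congrArg adjoint hVW.eq
  exact DFunLike.congr_fun (((star_mul V W).symm.trans this).trans (star_mul W V)) x |>.symm

theorem adjoint_mem_of_commute (hVW : Commute V W) (hH : H = W.rangeᗮ) {x : E} (hx : x ∈ H) :
    adjoint V x ∈ H := by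
  subst hH
  rw [mem_orthogonal_range] at hx ⊢
  rw [← adjoint_apply_comm hVW, hx, map_zero]

/-- Since `Hᗮ = ran W` is `V`-invariant, `P_H V = P_H V P_H`, and powers compress to powers. -/
theorem isIsometricDilation_compression [H.HasOrthogonalProjection] (hV : ∀ x, ‖V x‖ = ‖x‖)
    (hW : ∀ x, ‖W x‖ = ‖x‖) (hVW : Commute V W) (hH : H = W.rangeᗮ) {T : H →L[ℂ] H}
    (hT : ∀ x : H, T x = H.orthogonalProjectionOnto (V x)) : IsIsometricDilation H V T := by
  refine ⟨hV, fun n => ?_⟩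
  have hinv : ∀ y : E, H.orthogonalProjectionOnto (V y) =
      H.orthogonalProjectionOnto (V (H.orthogonalProjectionOnto y)) := by
    intro y
    rw [← sub_eq_zero, ← map_sub, ← map_sub, Submodule.orthogonalProjectionOnto_eq_zero_iff]
    have : y - H.orthogonalProjectionOnto y ∈ Hᗮ := Submodule.sub_starProjection_mem_orthogonal y
    subst hH
    rw [orthogonal_orthogonal_range hW] at this ⊢
    obtain ⟨z, hz⟩ := this
    rw [← hz]
    exact ⟨V z, (apply_comm hVW z).symm⟩
  induction n with
  | zero => intro x; simp
  | succ n ih =>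
    intro x
    rw [pow_succ', pow_succ', mul_apply_eq_comp, mul_apply_eq_comp, hinv, ih, hT]

/-- The complement of `M₊(H)` is `V*`-invariant and contained in `ran W`. Injectivity of `V* W`
makes `V V*` the identity there, so its elements lie in the range of every `V ^ n` and vanish by
purity. -/
theorem isMinimalIsometricDilation_compression [H.HasOrthogonalProjection]
    (hV : ∀ x, ‖V x‖ = ‖x‖) (hW : ∀ x, ‖W x‖ = ‖x‖) (hVW : Commute V W) (hH : H = W.rangeᗮ)
    (hpure : ∀ x, (∀ n : ℕ, ∃ y, (V ^ n) y = x) → x = 0)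
    (hker : ∀ x, adjoint V (W x) = 0 → x = 0) {T : H →L[ℂ] H}
    (hT : ∀ x : H, T x = H.orthogonalProjectionOnto (V x)) :
    IsMinimalIsometricDilation H V T := by
  refine ⟨isIsometricDilation_compression hV hW hVW hH hT, ?_⟩
  change MPlus V H = ⊤
  rw [← (isClosed_mPlus V H).submodule_topologicalClosure_eq,
    Submodule.topologicalClosure_eq_top_iff, Submodule.eq_bot_iff]
  have hrange : ∀ y ∈ (MPlus V H)ᗮ, ∃ z, W z = y := by
    intro y hy
    rw [mem_orthogonal_mPlus] at hy
    have : y ∈ Hᗮ := fun x hx => by simpa using hy 0 x hx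
    rw [hH, orthogonal_orthogonal_range hW] at this
    exact this
  have hadj : ∀ y ∈ (MPlus V H)ᗮ, adjoint V y ∈ (MPlus V H)ᗮ := by
    intro y hy
    rw [mem_orthogonal_mPlus] at hy ⊢
    intro n x hx
    rw [adjoint_inner_right]
    simpa [pow_succ'] using hy (n + 1) x hx
  have hV' : ∀ y ∈ (MPlus V H)ᗮ, V (adjoint V y) = y := by
    intro y hy
    obtain ⟨a, ha⟩ := hrange y hy
    obtain ⟨b, hb⟩ := hrange _ (hadj y hy)
    -- With `y = W a` and `V* y = W b`: `V* W (a - V b) = V* y - V* V W b = 0`.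
    have h0 : a - V b = 0 := by
      apply hker
      rw [map_sub, ← apply_comm hVW, ha, hb, map_sub, adjoint_apply_apply_of_isometry hV,
        sub_self]
    rw [← hb, apply_comm hVW, ← sub_eq_zero.1 h0, ha]
  intro y hy
  refine hpure y fun n => ?_
  suffices ∃ z ∈ (MPlus V H)ᗮ, (V ^ n) z = y from ⟨this.choose, this.choose_spec.2⟩
  induction n with
  | zero => exact ⟨y, hy, rfl⟩
  | succ n ih =>
    obtain ⟨z, hz, rfl⟩ := ih
    exact ⟨adjoint V z, hadj z hz, by rw [pow_succ, mul_apply_eq_comp, hV' z hz]⟩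

theorem isClosed_map_of_isometry (hW : ∀ x, ‖W x‖ = ‖x‖) {X : Submodule ℂ E}
    (hX : IsClosed (X : Set E)) : IsClosed (X.map W.toLinearMap : Set E) := by
  rw [Submodule.map_coe]
  exact (AddMonoidHomClass.isometry_of_norm W hW).isClosedEmbedding.isClosedMap _ hX

theorem isWanderingDecomposition_compression
    (hV : ∀ x, ‖V x‖ = ‖x‖) (hW : ∀ x, ‖W x‖ = ‖x‖) (hVW : Commute V W) (hH : H = W.rangeᗮ)
    (hpure : ∀ x, (∀ n : ℕ, ∃ y, (V ^ n) y = x) → x = 0) :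
    IsWanderingDecomposition H V (V.rangeᗮ.map W.toLinearMap) V.rangeᗮ := by
  have hwand := isWandering_orthogonal_range hV
  have htop := mPlus_orthogonal_range_eq_top hV hpure
  have hcomm : ∀ n : ℕ, ∀ x, (V ^ n) (W x) = W ((V ^ n) x) := fun n =>
    apply_comm (hVW.pow_left n)
  have hM : MPlus V (V.rangeᗮ.map W.toLinearMap) = W.range := by
    refine le_antisymm (mPlus_le (isClosed_range_of_isometry hW) ?_) ?_
    · rintro n _ ⟨x, -, rfl⟩
      exact ⟨(V ^ n) x, (hcomm n x).symm⟩
    · rintro _ ⟨x, rfl⟩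
      exact map_mPlus_of_commute hVW _ (htop ▸ Submodule.mem_top)
  have hclosed := isClosed_map_of_isometry hW hwand.isClosed
  refine ⟨(isWandering_iff_inner hclosed).2 ?_, hwand, htop, ?_, ?_⟩
  · rintro n m hnm _ ⟨x, hx, rfl⟩ _ ⟨y, hy, rfl⟩
    rw [coe_coe, hcomm, hcomm, inner_map_map_of_isometry hW]
    exact (isWandering_iff_inner hwand.isClosed).1 hwand n m hnm x hx y hy
  · rw [hM, hH]
    exact (Submodule.isOrtho_orthogonal_right _).symm
  · have : CompleteSpace W.range := (isClosed_range_of_isometry hW).completeSpace_coe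
    rw [hM, hH, sup_comm, Submodule.sup_orthogonal_of_hasOrthogonalProjection]

variable [CompleteSpace H]

theorem identifiesDefect_compression
    (hV : ∀ x, ‖V x‖ = ‖x‖) (hW : ∀ x, ‖W x‖ = ‖x‖) (hVW : Commute V W) (hH : H = W.rangeᗮ)
    (hker : ∀ x, adjoint V (W x) = 0 → x = 0) {T : H →L[ℂ] H}
    (hT : ∀ x : H, T x = H.orthogonalProjectionOnto (V x)) :
    IdentifiesDefect H V T (V.rangeᗮ.map W.toLinearMap) := by
  have horth : ∀ x : H, V x - T x ∈ Hᗮ := fun x => by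
    rw [hT]; exact Submodule.sub_starProjection_mem_orthogonal _
  refine exists_defectSpace_equiv
    (isClosed_map_of_isometry hW (Submodule.isClosed_orthogonal _))
    (V ∘L H.subtypeL - H.subtypeL ∘L T) (fun x => ?_) (fun x => ?_) ?_
  · have h := (congrArg Submodule.orthogonal hH).le (horth x)
    rw [orthogonal_orthogonal_range hW] at h
    obtain ⟨z, hz⟩ := h
    refine ⟨z, mem_orthogonal_range.2 ?_, hz⟩
    have hx : adjoint W x = 0 := mem_orthogonal_range.1 (hH ▸ x.2)
    have hTx : adjoint W (T x) = 0 := mem_orthogonal_range.1 (hH ▸ (T x).2)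
    -- `W*` kills `T x`; then `V* z = W* V* V x = W* x = 0`, which puts `z` in `(ran V)ᗮ`.
    have hz' : z = adjoint W (V x) := by
      rw [← adjoint_apply_apply_of_isometry hW z, ← coe_coe W, hz, map_sub, hTx, sub_zero]
    rw [hz', adjoint_apply_comm hVW, adjoint_apply_apply_of_isometry hV, hx]
  · have h := norm_add_sq_eq_norm_sq_add_norm_sq_of_inner_eq_zero (V x - T x) (T x : E)
      (Submodule.inner_left_of_mem_orthogonal (T x).2 (horth x))
    rw [sub_add_cancel, hV] at h
    change ‖V x - T x‖ ^ 2 = ‖(x : E)‖ ^ 2 - ‖(T x : E)‖ ^ 2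
    linarith
  · rintro _ ⟨y, hy, rfl⟩ h
    have hy' := mem_orthogonal_range.1 hy
    -- `T x ∈ H` is orthogonal to `W y`, so orthogonality to `V x - T x` is orthogonality to `V x`.
    -- Hence `V* W y = W z`, and applying `W*` gives `z = V* y = 0`.
    have hmem : adjoint V (W y) ∈ Hᗮ := by
      intro x hx
      have h1 : inner ℂ (V x - T ⟨x, hx⟩) (W y) = 0 := h ⟨x, hx⟩
      have h2 : inner ℂ ((T ⟨x, hx⟩ : H) : E) (W y) = 0 :=
        Submodule.inner_left_of_mem_orthogonal (LinearMap.mem_range_self W.toLinearMap y)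
          (hH ▸ (T ⟨x, hx⟩).2)
      rw [inner_sub_left, h2, sub_zero] at h1
      rw [adjoint_inner_right, h1]
    rw [hH, orthogonal_orthogonal_range hW] at hmem
    obtain ⟨z, hz⟩ := hmem
    have hz0 : z = 0 := by
      rw [← adjoint_apply_apply_of_isometry hW z, ← coe_coe W, hz, ← adjoint_apply_comm hVW,
        adjoint_apply_apply_of_isometry hW, hy']
    have : y = 0 := hker y (by rw [← hz, hz0, map_zero])
    rw [this, map_zero]

/-- `H` is `V*`-invariant, so no projection is needed on the adjoint side. -/
theorem adjoint_compression_apply (hVW : Commute V W) (hH : H = W.rangeᗮ) {T : H →L[ℂ] H}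
    (hT : ∀ x : H, T x = H.orthogonalProjectionOnto (V x)) (x : H) :
    ((adjoint T x : H) : E) = adjoint V x := by
  have : adjoint T x = ⟨adjoint V x, adjoint_mem_of_commute hVW hH x.2⟩ := by
    refine ext_inner_left ℂ fun y => ?_
    rw [adjoint_inner_right, hT, Submodule.inner_orthogonalProjectionOnto_eq_of_mem_right]
    exact (adjoint_inner_right V (y : E) (x : E)).symm
  rw [this]

theorem identifiesDefectStar_compression
    (hV : ∀ x, ‖V x‖ = ‖x‖) (hW : ∀ x, ‖W x‖ = ‖x‖) (hVW : Commute V W) (hH : H = W.rangeᗮ)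
    (hker : ∀ x, adjoint V (W x) = 0 → x = 0) {T : H →L[ℂ] H}
    (hT : ∀ x : H, T x = H.orthogonalProjectionOnto (V x)) :
    IdentifiesDefectStar H V T V.rangeᗮ := by
  have hadj := adjoint_compression_apply hVW hH hT
  have hmem : ∀ x : E, x - V (adjoint V x) ∈ V.rangeᗮ := fun x => by
    rw [mem_orthogonal_range, map_sub, adjoint_apply_apply_of_isometry hV, sub_self]
  refine exists_defectSpace_equiv (Submodule.isClosed_orthogonal _)
    (H.subtypeL - V ∘L H.subtypeL ∘L adjoint T) (fun x => ?_) (fun x => ?_) fun y hy h => ?_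
  · change (x : E) - V (adjoint T x : H) ∈ _
    rw [hadj]
    exact hmem x
  · change ‖(x : E) - V (adjoint T x : H)‖ ^ 2 = ‖(x : E)‖ ^ 2 - ‖((adjoint T x : H) : E)‖ ^ 2
    rw [hadj]
    have h := norm_add_sq_eq_norm_sq_add_norm_sq_of_inner_eq_zero ((x : E) - V (adjoint V x))
      (V (adjoint V x)) (Submodule.inner_left_of_mem_orthogonal
        (LinearMap.mem_range_self V.toLinearMap _) (hmem x))
    rw [sub_add_cancel, hV] at h
    linarith
  -- `y` is orthogonal to `ran V`, so only the term `x` survives. Then `y = W z` with `V* W z = 0`.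
  · have : y ∈ Hᗮ := by
      intro x hx
      have h1 : inner ℂ (x - V (adjoint T ⟨x, hx⟩ : H)) y = 0 := h ⟨x, hx⟩
      have h2 : inner ℂ (V (adjoint T ⟨x, hx⟩ : H)) y = 0 :=
        Submodule.inner_right_of_mem_orthogonal (LinearMap.mem_range_self V.toLinearMap _) hy
      rwa [inner_sub_left, h2, sub_zero] at h1
    rw [hH, orthogonal_orthogonal_range hW] at this
    obtain ⟨z, rfl⟩ := this
    rw [coe_coe, hker z (mem_orthogonal_range.1 hy), map_zero]

end Dilation

/-! ### Multiplication by inner functions on the Hardy space. -/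

section Hardy

theorem coeFn_mulOp (φ : LInfty) (f : L2) :
    mulOp φ f =ᵐ[AddCircle.haarAddCircle] fun t => φ t * f t :=
  (ContinuousLinearMap.mul ℂ ℂ).coeFn_holder φ f

theorem coeFn_mulLInfty (φ ψ : LInfty) :
    mulLInfty φ ψ =ᵐ[AddCircle.haarAddCircle] fun t => φ t * ψ t :=
  (ContinuousLinearMap.mul ℂ ℂ).coeFn_holder φ ψ

theorem fourierCoeff_eq_inner (f : L2) (n : ℤ) :
    fourierCoeff f n = inner ℂ (fourierLp (T := (1 : ℝ)) 2 n) f := by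
  rw [← fourierBasis_repr, HilbertBasis.repr_apply_apply, coe_fourierBasis]

theorem fourierCoeff_mulOp_fourierLp (φ : LInfty) (k n : ℤ) :
    fourierCoeff (mulOp φ (fourierLp 2 k)) n = fourierCoeff φ (n - k) := by
  refine integral_congr_ae ?_
  filter_upwards [coeFn_mulOp φ (fourierLp 2 k), coeFn_fourierLp (T := (1 : ℝ)) 2 k]
    with t h1 h2
  rw [h1, h2, neg_sub, sub_eq_add_neg, fourier_add, smul_eq_mul, smul_eq_mul]
  ring

theorem hasSum_fourierCoeff_mulOp (φ : LInfty) (f : L2) (n : ℤ) :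
    HasSum (fun k => fourierCoeff f k * fourierCoeff φ (n - k)) (fourierCoeff (mulOp φ f) n) := by
  have h := (hasSum_fourier_series_L2 f).mapL
    ((innerSL ℂ (fourierLp (T := (1 : ℝ)) 2 n)) ∘L mulOp φ)
  simpa only [ContinuousLinearMap.comp_apply, map_smul, innerSL_apply_apply,
    ← fourierCoeff_eq_inner, fourierCoeff_mulOp_fourierLp, smul_eq_mul] using h

variable {B θ : LInfty}

/-- In the convolution of Fourier coefficients, terms `k < n` vanish through `f` and terms `k > n`
through `B`. -/
theorem IsInner.fourierCoeff_mulOp_of_lt (hB : IsInner B) {f : L2} {n : ℤ}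
    (hf : ∀ k < n, fourierCoeff f k = 0) :
    fourierCoeff (mulOp B f) n = fourierCoeff f n * fourierCoeff B 0 := by
  refine (hasSum_fourierCoeff_mulOp B f n).unique ?_
  have h := hasSum_single (f := fun k => fourierCoeff f k * fourierCoeff B (n - k)) n
    fun k hk => ?_
  · simpa using h
  · rcases lt_or_gt_of_ne hk with hk | hk
    · rw [hf k hk, zero_mul]
    · rw [hB.fourierCoeff_eq_zero _ (by omega), mul_zero]

theorem IsInner.mulOp_mem (hB : IsInner B) {f : L2} (hf : f ∈ H2) : mulOp B f ∈ H2 := by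
  intro n hn
  rw [hB.fourierCoeff_mulOp_of_lt fun k hk => hf k (hk.trans hn), hf n hn, zero_mul]

theorem IsInner.coe_toeplitz (hB : IsInner B) (f : H2) : (toeplitz B f : L2) = mulOp B f :=
  congrArg Subtype.val
    (H2.orthogonalProjectionOnto_mem_subspace_eq_self ⟨mulOp B f, hB.mulOp_mem f.2⟩)

theorem IsInner.norm_mulOp (hB : IsInner B) (f : L2) : ‖mulOp B f‖ = ‖f‖ := by
  rw [Lp.norm_def, Lp.norm_def]
  congr 1
  refine eLpNorm_congr_norm_ae ?_
  filter_upwards [coeFn_mulOp B f, hB.norm_eq_one] with t h1 h2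
  rw [h1, norm_mul, h2, one_mul]

theorem IsInner.norm_toeplitz (hB : IsInner B) (f : H2) : ‖toeplitz B f‖ = ‖f‖ := by
  change ‖(toeplitz B f : L2)‖ = ‖(f : L2)‖
  rw [hB.coe_toeplitz, hB.norm_mulOp]

theorem mulOp_comm (φ ψ : LInfty) (f : L2) : mulOp φ (mulOp ψ f) = mulOp ψ (mulOp φ f) := by
  refine Lp.ext ?_
  filter_upwards [coeFn_mulOp φ (mulOp ψ f), coeFn_mulOp ψ (mulOp φ f), coeFn_mulOp φ f,
    coeFn_mulOp ψ f] with t h1 h2 h3 h4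
  rw [h1, h2, h3, h4]
  ring

theorem IsInner.commute_toeplitz (hB : IsInner B) (hθ : IsInner θ) :
    Commute (toeplitz B) (toeplitz θ) := by
  refine ContinuousLinearMap.ext fun f => Subtype.ext ?_
  rw [mul_apply_eq_comp, mul_apply_eq_comp, hB.coe_toeplitz, hθ.coe_toeplitz, hθ.coe_toeplitz,
    hB.coe_toeplitz, mulOp_comm]

theorem IsInner.innerMul_eq_map (hθ : IsInner θ) (X : Submodule ℂ H2) :
    innerMul θ X = X.map (toeplitz θ).toLinearMap := by
  ext f
  constructor
  · rintro ⟨_, ⟨g, hg, rfl⟩, hf⟩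
    exact ⟨g, hg, Subtype.ext ((hθ.coe_toeplitz g).trans hf)⟩
  · rintro ⟨g, hg, rfl⟩
    exact ⟨g, ⟨g, hg, rfl⟩, (hθ.coe_toeplitz g).symm⟩

theorem IsInner.modelSpace_eq (hθ : IsInner θ) :
    modelSpace θ = (toeplitz θ).rangeᗮ := by
  rw [modelSpace, hθ.innerMul_eq_map, Submodule.map_top]

theorem inner_mulOp_mulLInfty_star (φ ψ : LInfty) (f g : L2) :
    inner ℂ g (mulOp (mulLInfty φ (star ψ)) f) = inner ℂ (mulOp ψ g) (mulOp φ f) := by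
  rw [L2.inner_def, L2.inner_def]
  refine integral_congr_ae ?_
  filter_upwards [coeFn_mulOp (mulLInfty φ (star ψ)) f, coeFn_mulLInfty φ (star ψ),
    Lp.coeFn_star ψ, coeFn_mulOp ψ g, coeFn_mulOp φ f] with t h1 h2 h3 h4 h5
  rw [h1, h2, h3, h4, h5, RCLike.inner_apply, RCLike.inner_apply, Pi.star_apply, map_mul,
    starRingEnd_apply, starRingEnd_apply]
  ring

theorem IsInner.toeplitz_mulLInfty_star (hB : IsInner B) (hθ : IsInner θ) (f : H2) :
    toeplitz (mulLInfty θ (star B)) f =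
      ContinuousLinearMap.adjoint (toeplitz B) (toeplitz θ f) := by
  refine ext_inner_left ℂ fun g => ?_
  rw [ContinuousLinearMap.adjoint_inner_right, Submodule.coe_inner (W := H2) (toeplitz B g),
    hB.coe_toeplitz, hθ.coe_toeplitz, ← inner_mulOp_mulLInfty_star]
  exact Submodule.inner_orthogonalProjectionOnto_eq_of_mem_left g _

/-- The coefficient is `⟨1, B⟩` with both functions of norm one; equality in Cauchy–Schwarz would
make `B` a multiple of `1`. This strict inequality drives purity. -/
theorem IsInner.norm_fourierCoeff_zero_lt_one (hB : IsInner B) (hBc : ¬ IsConstant B) :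
    ‖fourierCoeff B 0‖ < 1 := by
  set e : L2 := fourierLp (T := (1 : ℝ)) 2 0 with he
  have hnorm : ‖e‖ = 1 := (orthonormal_fourier (T := (1 : ℝ))).norm_eq_one 0
  have hcoeff : fourierCoeff B 0 = inner ℂ e (mulOp B e) := by
    rw [← fourierCoeff_eq_inner, fourierCoeff_mulOp_fourierLp, sub_zero]
  have hBe : ‖mulOp B e‖ = 1 := (hB.norm_mulOp e).trans hnorm
  have hle : ‖inner ℂ e (mulOp B e)‖ ≤ ‖e‖ * ‖mulOp B e‖ := norm_inner_le_norm _ _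
  rw [hcoeff]
  refine lt_of_le_of_ne (by simpa [hnorm, hBe] using hle) fun h => hBc ?_
  obtain ⟨r, -, hr⟩ := (norm_inner_eq_norm_iff (𝕜 := ℂ) (x := e) (y := mulOp B e)
    (norm_ne_zero_iff.1 (by simp [hnorm])) (norm_ne_zero_iff.1 (by simp [hBe]))).1
    (by rw [h, hnorm, hBe, one_mul])
  refine ⟨r, ?_⟩
  filter_upwards [coeFn_mulOp B e, coeFn_fourierLp (T := (1 : ℝ)) 2 0, Lp.coeFn_smul r e]
    with t h1 h2 h3
  rw [← hr, h1, Pi.smul_apply, he, h2] at h3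
  simpa using h3

/-- Multiplication by a nonconstant inner function is a pure isometry of `H²`. -/
theorem IsInner.toeplitz_pure (hB : IsInner B) (hBc : ¬ IsConstant B) (f : H2)
    (hf : ∀ n : ℕ, ∃ g, (toeplitz B ^ n) g = f) : f = 0 := by
  have hinj : Function.Injective (toeplitz B) :=
    (AddMonoidHomClass.isometry_of_norm _ hB.norm_toeplitz).injective
  have hdiv : ∀ f : H2, (∀ n : ℕ, ∃ g, (toeplitz B ^ n) g = f) →
      ∃ f₁ : H2, toeplitz B f₁ = f ∧ ∀ n : ℕ, ∃ g, (toeplitz B ^ n) g = f₁ := by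
    intro f hf
    obtain ⟨f₁, rfl⟩ := hf 1
    refine ⟨f₁, by simp, fun n => ?_⟩
    obtain ⟨g, hg⟩ := hf (n + 1)
    refine ⟨g, hinj ?_⟩
    rw [pow_one, pow_succ', mul_apply_eq_comp] at hg
    exact hg
  have hlt := hB.norm_fourierCoeff_zero_lt_one hBc
  have hzero : ∀ k : ℕ, ∀ f : H2, (∀ n : ℕ, ∃ g, (toeplitz B ^ n) g = f) →
      fourierCoeff (f : L2) k = 0 := by
    intro k
    induction k using Nat.strong_induction_on with
    | _ k ih =>
      -- By `ih` all coefficients below `k` vanish for every infinitely divisible function, so each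
      -- division by `B` contributes one factor `‖fourierCoeff B 0‖` to the `k`-th coefficient
      -- without changing the norm; letting `n → ∞` annihilates it.
      have hbound : ∀ n : ℕ, ∀ f : H2, (∀ n : ℕ, ∃ g, (toeplitz B ^ n) g = f) →
          ‖fourierCoeff (f : L2) k‖ ≤ ‖fourierCoeff B 0‖ ^ n * ‖f‖ := by
        intro n
        induction n with
        | zero =>
          intro f _
          rw [pow_zero, one_mul, fourierCoeff_eq_inner]
          refine (norm_inner_le_norm _ _).trans_eq ?_
          rw [(orthonormal_fourier (T := (1 : ℝ))).norm_eq_one, one_mul, Submodule.coe_norm]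
        | succ n ihn =>
          intro f hf
          obtain ⟨f₁, rfl, hf₁⟩ := hdiv f hf
          have hlow : ∀ j < (k : ℤ), fourierCoeff (f₁ : L2) j = 0 := by
            intro j hj
            rcases lt_or_ge j 0 with h | h
            · exact f₁.2 j h
            · obtain ⟨i, rfl⟩ := Int.eq_ofNat_of_zero_le h
              exact ih i (by exact_mod_cast hj) f₁ hf₁
          rw [hB.coe_toeplitz, hB.fourierCoeff_mulOp_of_lt hlow, norm_mul, hB.norm_toeplitz,
            mul_comm, pow_succ', mul_assoc]
          exact mul_le_mul_of_nonneg_left (ihn f₁ hf₁) (norm_nonneg _)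
      intro f hf
      have hlim := (tendsto_pow_atTop_nhds_zero_of_lt_one (norm_nonneg _) hlt).mul_const ‖f‖
      rw [zero_mul] at hlim
      exact norm_le_zero_iff.1 (ge_of_tendsto' hlim fun n => hbound n f hf)
  refine Subtype.ext ((fourierBasis (T := (1 : ℝ))).repr.injective ?_)
  ext n
  rw [fourierBasis_repr, Submodule.coe_zero, map_zero]
  rcases lt_or_ge n 0 with h | h
  · exact f.2 n h
  · obtain ⟨k, rfl⟩ := Int.eq_ofNat_of_zero_le h
    exact hzero k f hf

end Hardy

end HardyDilation

theorem mainTheorem6 (B θ : HardyDilation.LInfty)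
    (hB : HardyDilation.IsInner B) (hθ : HardyDilation.IsInner θ)
    (hBc : ¬ HardyDilation.IsConstant B)
    (hker : (HardyDilation.toeplitz (HardyDilation.mulLInfty θ (star B))).ker = ⊥) :
    -- `T_B` is a minimal isometric dilation of `A^θ_B`
    HardyDilation.IsMinimalIsometricDilation (HardyDilation.modelSpace θ)
      (HardyDilation.toeplitz B) (HardyDilation.truncatedToeplitz θ B) ∧
    -- `L = θ K_B` and `L_* = K_B` are wandering, with `H² = M₊(L_*) = K_θ ⊕ M₊(L)`
    HardyDilation.IsWanderingDecomposition (HardyDilation.modelSpace θ)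
      (HardyDilation.toeplitz B)
      (HardyDilation.innerMul θ (HardyDilation.modelSpace B)) (HardyDilation.modelSpace B) ∧
    -- they are the only such subspaces
    (∀ L Lstar : Submodule ℂ HardyDilation.H2,
      HardyDilation.IsWanderingDecomposition (HardyDilation.modelSpace θ)
        (HardyDilation.toeplitz B) L Lstar →
      L = HardyDilation.innerMul θ (HardyDilation.modelSpace B) ∧
        Lstar = HardyDilation.modelSpace B) ∧
    -- `D_T x ↦ (V - T) x` extends to a unitary from the defect space of `T = A^θ_B` onto `L`
    HardyDilation.IdentifiesDefect (HardyDilation.modelSpace θ)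
      (HardyDilation.toeplitz B) (HardyDilation.truncatedToeplitz θ B)
      (HardyDilation.innerMul θ (HardyDilation.modelSpace B)) ∧
    -- `D_{T*} x ↦ x - V T* x` extends to a unitary from the defect space of `T*` onto `L_*`
    HardyDilation.IdentifiesDefectStar (HardyDilation.modelSpace θ)
      (HardyDilation.toeplitz B) (HardyDilation.truncatedToeplitz θ B)
      (HardyDilation.modelSpace B) := by
  have hV := hB.norm_toeplitz
  have hW := hθ.norm_toeplitz
  have hVW := hB.commute_toeplitz hθ
  have hH := hθ.modelSpace_eq
  have hpure := hB.toeplitz_pure hBc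
  have hadj : ∀ x, ContinuousLinearMap.adjoint (HardyDilation.toeplitz B)
      (HardyDilation.toeplitz θ x) = 0 → x = 0 := fun x hx => by
    rw [← hB.toeplitz_mulLInfty_star hθ] at hx
    exact (Submodule.mem_bot ℂ).1 (hker ▸ LinearMap.mem_ker.2 hx)
  have hT : ∀ x : HardyDilation.modelSpace θ, HardyDilation.truncatedToeplitz θ B x =
      (HardyDilation.modelSpace θ).orthogonalProjectionOnto (HardyDilation.toeplitz B x) :=
    fun _ => rfl
  rw [hθ.innerMul_eq_map (HardyDilation.modelSpace B), hB.modelSpace_eq]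
  have hdec := HardyDilation.isWanderingDecomposition_compression hV hW hVW hH hpure
  exact ⟨HardyDilation.isMinimalIsometricDilation_compression hV hW hVW hH hpure hadj hT, hdec,
    fun L Lstar h => h.unique hdec,
    HardyDilation.identifiesDefect_compression hV hW hVW hH hadj hT,
    HardyDilation.identifiesDefectStar_compression hV hW hVW hH hadj hT⟩
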